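/- Let $\varphi:\mathbb R\to\mathbb C$ be continuous on $\mathbb R$ and $C^1$ on $\mathbb R\setminus\{0\}$, with $\varphi(0)=1$ and $\operatorname{supp}\varphi\subset[-1,1]$. Suppose that for some $\varepsilon>0$ the functions $\varphi(x)$ (on $\mathbb R$) and $x\varphi'(x)$ (on $\mathbb R\setminus\{0\}$) both have finite total variation and both satisfy a Lipschitz (Hölder) condition of order $\varepsilon$, i.e. $|g(x)-g(y)|\le C|x-y|^{\varepsilon}$ for all $x,y$ in the domain, with some constant $C$. Let $f\in L_1(\mathbb T)$ be complex-valued and $2\pi$-periodic, $\mathbb T=\mathbb R/2\pi\mathbb Z$, with Fourier coefficients $\widehat f_k=\frac1{2\pi}\int_{-\pi}^{\pi}f(t)e^{-ikt}\,dt$. Then at every $d$-point $x$ of $f$, that is, at every $x$ for which the (two-sided) limit $$d_f(x)=\lim_{h\to0}\frac1h\int_0^h f(x+t)\,dt$$ exists and is finite, $$\lim_{n\to\infty}\ \sum_{|k|\le n}\varphi\Big(\frac{k}{n+1}\Big)\widehat f_k\,e^{ikx}=d_f(x).$$ -/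

import Mathlib

open MeasureTheory Filter Topology
open scoped NNReal Real

instance instFactTwoPiPos : Fact (0 < 2 * π) := ⟨Real.two_pi_pos⟩

/-- `x` is a `d`-point of the function `f` on the circle `ℝ / 2πℤ`, with value `d = d_f(x)`:
the means `(1/h) ∫₀ʰ f(x+t) dt` converge to `d` as `h → 0`, `h ≠ 0` (from both sides). For
integrable `f` this says that the indefinite integral of `f` has derivative `d` at `x`. -/
def HasDValueAt (f : AddCircle (2 * π) → ℂ) (x : AddCircle (2 * π)) (d : ℂ) : Prop :=
  Tendsto (fun h : ℝ => (1 / (h : ℂ)) * ∫ t in (0 : ℝ)..h, f (x + (t : AddCircle (2 * π))))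
    (𝓝[≠] 0) (𝓝 d)

/-- The class `V ∩ Lip ε` on a set `s` of reals: finite total variation on `s`, and a Lipschitz
condition of order `ε`, `|g(x) - g(y)| ≤ C |x - y| ^ ε` for `x, y ∈ s`. -/
def BVLipOn (ε : ℝ≥0) (g : ℝ → ℂ) (s : Set ℝ) : Prop :=
  BoundedVariationOn g s ∧ ∃ C : ℝ≥0, HolderOnWith C ε g s

/-- The means `∑_{|k| ≤ n} φ(k/(n+1)) f̂ₖ e^{ikx}` of the Fourier series of `f`. -/
noncomputable def phiMean (φ : ℝ → ℂ) (f : AddCircle (2 * π) → ℂ) (n : ℕ)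
    (x : AddCircle (2 * π)) : ℂ :=
  ∑ k ∈ Finset.Icc (-(n : ℤ)) (n : ℤ),
    φ ((k : ℝ) / ((n : ℝ) + 1)) * fourierCoeff f k * fourier k x

/-! Let `P y = y φ(y)`. The multiplier `φ(k / N)` is the difference quotient of `P` between `0` and
`k / N`, so the mean is, up to a constant, the integral of `𝓕 P v` against `N` times the indefinite
integral of `f` from `x` to `x + 2π v / N`. That has derivative `d` at `0` and is bounded by a
multiple of the length of the arc, so dominated convergence gives the limit as soon as `v 𝓕 P v` is
integrable, i.e. as soon as `P' = φ + y φ'` has an integrable Fourier transform. This is Bernstein's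
argument: if `g` has bounded variation and is Hölder of order `ε`, the squared `L²` norm of
`g(· + h) - g` is `O(h ^ (1 + ε))`, so by Plancherel and Cauchy–Schwarz the integral of `|𝓕 g|` over
the shell `1 / 4 ≤ |h u| ≤ 1 / 2` is `O(h ^ (ε / 2))`, which is summable over `h = 2 ^ (-k)`. -/

open scoped FourierTransform ENNReal

section Plancherel

variable {V F : Type*} [NormedAddCommGroup V] [InnerProductSpace ℝ V] [FiniteDimensional ℝ V]
  [MeasurableSpace V] [BorelSpace V] [NormedAddCommGroup F]

theorem continuous_fourier_of_integrable [NormedSpace ℂ F] {f : V → F} (hf : Integrable f) :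
    Continuous (𝓕 f) :=
  VectorFourier.fourierIntegral_continuous Real.continuous_fourierChar
    (innerSL ℝ).continuous₂ hf

variable [InnerProductSpace ℂ F] [CompleteSpace F]

theorem fourier_toLp_ae_eq {f : V → F} (hf : Integrable f) (hf2 : MemLp f 2) :
    (𝓕 (hf2.toLp f) : Lp F 2 (volume : Measure V)) =ᵐ[volume] 𝓕 f := by
  refine ae_eq_of_integral_contDiff_smul_eq
    ((Lp.memLp _).locallyIntegrable (by norm_num))
    (continuous_fourier_of_integrable hf).locallyIntegrable fun g hg hgc => ?_
  let G : SchwartzMap V ℂ :=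
    (hgc.comp_left (g := ((↑) : ℝ → ℂ)) Complex.ofReal_zero).toSchwartzMap
      (Complex.ofRealCLM.contDiff.comp hg)
  have hG : ∀ (u : V) (w : F), G u • w = g u • w := fun u w => Complex.coe_smul (g u) w
  calc ∫ u, g u • (𝓕 (hf2.toLp f) : Lp F 2 (volume : Measure V)) u
      = ∫ u, 𝓕 (G : V → ℂ) u • hf2.toLp f u := by
        simpa only [TemperedDistribution.fourier_apply, Lp.toTemperedDistribution_apply,
          SchwartzMap.fourier_coe, hG] using
          (congrArg (· G) (Lp.fourier_toTemperedDistribution_eq (hf2.toLp f))).symm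
    _ = ∫ u, 𝓕 (G : V → ℂ) u • f u := by
        refine integral_congr_ae ?_
        filter_upwards [hf2.coeFn_toLp] with u hu
        rw [hu]
    _ = ∫ u, G u • 𝓕 f u := by
        exact (VectorFourier.integral_fourierIntegral_smul_eq_flip (L := innerₗ V)
          Real.continuous_fourierChar continuous_inner G.integrable hf).trans
            (by rw [flip_innerₗ]; rfl)
    _ = ∫ u, g u • 𝓕 f u := by simp only [hG]

theorem eLpNorm_fourier_two {f : V → F} (hf : Integrable f) (hf2 : MemLp f 2) :
    eLpNorm (𝓕 f) 2 = eLpNorm f 2 := by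
  rw [← eLpNorm_congr_ae (fourier_toLp_ae_eq hf hf2), ← eLpNorm_congr_ae hf2.coeFn_toLp,
    ← Lp.enorm_def, ← Lp.enorm_def, ← ofReal_norm, ← ofReal_norm, Lp.norm_fourier_eq]

end Plancherel

section Translation

theorem tsum_edist_le_eVariationOn {α E : Type*} [LinearOrder α] [PseudoEMetricSpace E]
    (g : α → E) {s : Set α} {u : ℤ → α} (hu : Monotone u) (hus : ∀ k, u k ∈ s) :
    ∑' k : ℤ, edist (g (u (k + 1))) (g (u k)) ≤ eVariationOn g s := by
  let shift (m : ℕ) : ℕ ↪ ℤ := ⟨fun i => i - m, fun i j h => by simpa using h⟩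
  have shift_apply (m i : ℕ) : shift m i = i - m := rfl
  have hexhaust (t : Finset ℤ) : ∃ m, t ⊆ (Finset.range (2 * m)).map (shift m) := by
    refine ⟨t.sup Int.natAbs + 1, fun k hk => ?_⟩
    have := Finset.le_sup (f := Int.natAbs) hk
    simp only [Finset.mem_map, Finset.mem_range, shift_apply]
    exact ⟨(k + (t.sup Int.natAbs + 1 : ℕ)).toNat, by omega, by omega⟩
  rw [ENNReal.tsum_eq_iSup_sum' _ hexhaust]
  refine iSup_le fun m => ?_
  have hsucc (i : ℕ) : shift m i + 1 = shift m (i + 1) := by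
    simp only [shift_apply]; push_cast; ring
  simp only [Finset.sum_map, hsucc]
  refine eVariationOn.sum_le (u := fun i => u (shift m i)) (fun i j hij => hu ?_) fun i => hus _
  simpa only [shift_apply, sub_le_sub_iff_right, Nat.cast_le] using hij

variable {E : Type*}

theorem lintegral_edist_comp_add_right_le [PseudoMetricSpace E] {g : ℝ → E}
    (hg : AEStronglyMeasurable g) {s : Set ℝ} (hs : ∀ᵐ x, x ∈ s) {h : ℝ} (hh : 0 < h) :
    ∫⁻ x, edist (g (x + h)) (g x) ≤ ENNReal.ofReal h * eVariationOn g s := by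
  have hshift (k : ℤ) : MeasurePreserving (fun y : ℝ => y + k * h) :=
    measurePreserving_add_right volume _
  have hstep : AEMeasurable fun x => edist (g (x + h)) (g x) :=
    (hg.comp_measurePreserving (measurePreserving_add_right volume h)).edist hg
  have hmem : ∀ᵐ y, ∀ k : ℤ, y + k * h ∈ s :=
    ae_all_iff.2 fun k => (hshift k).quasiMeasurePreserving.ae hs
  calc ∫⁻ x, edist (g (x + h)) (g x)
      = ∑' k : ℤ, ∫⁻ y in Set.Ioc 0 h, edist (g (y + k * h + h)) (g (y + k * h)) := by
        rw [← setLIntegral_univ, ← iUnion_Ioc_zsmul hh,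
          lintegral_iUnion (fun _ => measurableSet_Ioc) (Set.pairwise_disjoint_Ioc_zsmul h)]
        refine tsum_congr fun k => ?_
        rw [← (hshift k).setLIntegral_comp_preimage_emb (measurableEmbedding_addRight _)]
        congr 2
        simp [add_mul]
    _ = ∫⁻ y in Set.Ioc 0 h, ∑' k : ℤ, edist (g (y + ((k + 1 : ℤ) : ℝ) * h)) (g (y + k * h)) := by
        simp only [Int.cast_add, Int.cast_one, add_mul, one_mul, ← add_assoc]
        exact (lintegral_tsum fun k => (hstep.comp_quasiMeasurePreserving
          (hshift k).quasiMeasurePreserving).restrict).symm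
    _ ≤ ∫⁻ _ in Set.Ioc 0 h, eVariationOn g s := by
        refine lintegral_mono_ae (ae_restrict_of_ae ?_)
        filter_upwards [hmem] with y hy
        refine tsum_edist_le_eVariationOn g (u := fun k : ℤ => y + k * h) (fun j k hjk => ?_) hy
        simp only
        gcongr
    _ = ENNReal.ofReal h * eVariationOn g s := by simp [mul_comm]

theorem eLpNorm_comp_add_right_sub_two_le [NormedAddCommGroup E] {g : ℝ → E}
    (hg : AEStronglyMeasurable g) {s : Set ℝ} (hs : ∀ᵐ x, x ∈ s) {C ε : ℝ≥0}
    (hC : HolderOnWith C ε g s) {h : ℝ} (hh : 0 < h) :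
    eLpNorm (fun x => g (x + h) - g x) 2 ≤
      (C * eVariationOn g s * ENNReal.ofReal h ^ (1 + (ε : ℝ))) ^ (1 / 2 : ℝ) := by
  have hs' : ∀ᵐ x, x + h ∈ s :=
    (measurePreserving_add_right volume h).quasiMeasurePreserving.ae hs
  have hh0 : ENNReal.ofReal h ≠ 0 := by simpa using hh
  rw [eLpNorm_eq_lintegral_rpow_enorm_toReal two_ne_zero ENNReal.ofNat_ne_top]
  simp only [ENNReal.toReal_ofNat, ENNReal.rpow_ofNat, ← edist_eq_enorm_sub]
  gcongr
  calc ∫⁻ x, edist (g (x + h)) (g x) ^ 2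
      ≤ ∫⁻ x, C * ENNReal.ofReal h ^ (ε : ℝ) * edist (g (x + h)) (g x) := by
        refine lintegral_mono_ae ?_
        filter_upwards [hs, hs'] with x hx hx'
        have hdist : edist (x + h) x = ENNReal.ofReal h := by
          rw [edist_dist, Real.dist_eq, add_sub_cancel_left, abs_of_pos hh]
        rw [sq, ← hdist]
        gcongr
        exact hC _ hx' _ hx
    _ = C * ENNReal.ofReal h ^ (ε : ℝ) * ∫⁻ x, edist (g (x + h)) (g x) :=
        lintegral_const_mul' _ _ (by finiteness)
    _ ≤ C * ENNReal.ofReal h ^ (ε : ℝ) * (ENNReal.ofReal h * eVariationOn g s) := by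
        gcongr
        exact lintegral_edist_comp_add_right_le hg hs hh
    _ = C * eVariationOn g s * ENNReal.ofReal h ^ (1 + (ε : ℝ)) := by
        rw [ENNReal.rpow_add _ _ hh0 ENNReal.ofReal_ne_top, ENNReal.rpow_one]
        ring

end Translation

section Bernstein

theorem fourier_comp_add_right_sub {V F : Type*} [NormedAddCommGroup V] [InnerProductSpace ℝ V]
    [FiniteDimensional ℝ V] [MeasurableSpace V] [BorelSpace V] [NormedAddCommGroup F]
    [NormedSpace ℂ F] {g : V → F} (hg : Integrable g) (h u : V) :
    𝓕 (fun x => g (x + h) - g x) u = ((𝐞 (inner ℝ h u) : ℂ) - 1) • 𝓕 g u := by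
  have hshift : 𝓕 (fun x => g (x + h)) u = (𝐞 (inner ℝ h u) : ℂ) • 𝓕 g u :=
    congrFun (VectorFourier.fourierIntegral_comp_add_right 𝐞 volume (innerₗ V) g h) u
  rw [sub_smul, one_smul, ← hshift]
  simp only [Real.fourier_eq, smul_sub]
  exact integral_sub ((Real.fourierIntegral_convergent_iff u).2 (hg.comp_add_right h))
    ((Real.fourierIntegral_convergent_iff u).2 hg)

theorem one_le_norm_fourierChar_sub_one {θ : ℝ} (h1 : 1 / 4 ≤ |θ|) (h2 : |θ| ≤ 1 / 2) :
    1 ≤ ‖(𝐞 θ : ℂ) - 1‖ := by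
  have hcos : Real.cos (2 * π * θ) ≤ 0 := by
    rw [← Real.cos_abs, abs_mul, abs_of_pos Real.two_pi_pos]
    apply Real.cos_nonpos_of_pi_div_two_le_of_le <;> nlinarith [Real.pi_pos]
  calc (1 : ℝ) ≤ |((𝐞 θ : ℂ) - 1).re| := by
        rw [Real.fourierChar_apply, Complex.sub_re, Complex.exp_ofReal_mul_I_re, Complex.one_re,
          abs_of_nonpos (by linarith)]
        linarith
    _ ≤ ‖(𝐞 θ : ℂ) - 1‖ := Complex.abs_re_le_norm _

theorem volume_abs_mul_mem_Icc_le {h : ℝ} (hh : 0 < h) :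
    volume {u : ℝ | |h * u| ∈ Set.Icc (1 / 4) (1 / 2)} ≤ ENNReal.ofReal h⁻¹ := by
  have hsub : {u : ℝ | |h * u| ∈ Set.Icc (1 / 4) (1 / 2)} ⊆ Metric.closedBall 0 (h⁻¹ / 2) := by
    intro u hu
    have hu2 : h * |u| ≤ 1 / 2 := by rw [← abs_of_pos hh, ← abs_mul]; exact hu.2
    rw [mem_closedBall_zero_iff, Real.norm_eq_abs, div_eq_mul_one_div, le_inv_mul_iff₀ hh]
    exact hu2
  refine (measure_mono hsub).trans_eq ?_
  rw [Real.volume_closedBall]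
  ring_nf

variable {F : Type*} [NormedAddCommGroup F] [InnerProductSpace ℂ F] [CompleteSpace F] {g : ℝ → F}

theorem setLIntegral_enorm_fourier_le (hg : Integrable g) (hg2 : MemLp g 2) {h : ℝ} (hh : 0 < h) :
    ∫⁻ u in {u : ℝ | |h * u| ∈ Set.Icc (1 / 4) (1 / 2)}, ‖𝓕 g u‖ₑ ≤
      eLpNorm (fun x => g (x + h) - g x) 2 volume * ENNReal.ofReal h⁻¹ ^ (1 / 2 : ℝ) := by
  set S : Set ℝ := {u : ℝ | |h * u| ∈ Set.Icc (1 / 4) (1 / 2)}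
  set Δ : ℝ → F := fun x => g (x + h) - g x with hΔ
  have hSm : MeasurableSet S := by measurability
  have hΔ1 : Integrable Δ := (hg.comp_add_right h).sub hg
  have hΔ2 : MemLp Δ 2 :=
    (hg2.comp_measurePreserving (measurePreserving_add_right volume h)).sub hg2
  calc ∫⁻ u in S, ‖𝓕 g u‖ₑ
      ≤ ∫⁻ u in S, ‖𝓕 Δ u‖ₑ := by
        refine setLIntegral_mono' hSm fun u hu => ?_
        have hu1 := one_le_norm_fourierChar_sub_one hu.1 hu.2
        rw [hΔ, fourier_comp_add_right_sub hg, enorm_smul, RCLike.inner_apply, conj_trivial,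
          mul_comm u]
        exact le_mul_of_one_le_left' (by rwa [← ofReal_norm, ENNReal.one_le_ofReal])
    _ = eLpNorm (𝓕 Δ) 1 (volume.restrict S) := eLpNorm_one_eq_lintegral_enorm.symm
    _ ≤ eLpNorm (𝓕 Δ) 2 (volume.restrict S) * volume S ^ (1 / 2 : ℝ) := by
        refine (eLpNorm_le_eLpNorm_mul_rpow_measure_univ one_le_two
          (continuous_fourier_of_integrable hΔ1).aestronglyMeasurable).trans_eq ?_
        rw [Measure.restrict_apply_univ]
        norm_num
    _ ≤ eLpNorm (𝓕 Δ) 2 volume * ENNReal.ofReal h⁻¹ ^ (1 / 2 : ℝ) := by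
        gcongr
        · exact Measure.restrict_le_self
        · exact volume_abs_mul_mem_Icc_le hh
    _ = eLpNorm Δ 2 volume * ENNReal.ofReal h⁻¹ ^ (1 / 2 : ℝ) := by rw [eLpNorm_fourier_two hΔ1 hΔ2]

theorem setLIntegral_enorm_fourier_le_of_holderOnWith {C ε : ℝ≥0} {s : Set ℝ}
    (hC : HolderOnWith C ε g s) (hs : ∀ᵐ x, x ∈ s) (hg : Integrable g) (hg2 : MemLp g 2) {h : ℝ}
    (hh : 0 < h) :
    ∫⁻ u in {u : ℝ | |h * u| ∈ Set.Icc (1 / 4) (1 / 2)}, ‖𝓕 g u‖ₑ ≤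
      (C * eVariationOn g s * ENNReal.ofReal h ^ (ε : ℝ)) ^ (1 / 2 : ℝ) := by
  have hh0 : ENNReal.ofReal h ≠ 0 := by simpa using hh
  calc ∫⁻ u in {u : ℝ | |h * u| ∈ Set.Icc (1 / 4) (1 / 2)}, ‖𝓕 g u‖ₑ
      ≤ eLpNorm (fun x => g (x + h) - g x) 2 volume * ENNReal.ofReal h⁻¹ ^ (1 / 2 : ℝ) :=
        setLIntegral_enorm_fourier_le hg hg2 hh
    _ ≤ (C * eVariationOn g s * ENNReal.ofReal h ^ (1 + (ε : ℝ))) ^ (1 / 2 : ℝ) *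
          ENNReal.ofReal h⁻¹ ^ (1 / 2 : ℝ) := by
        gcongr
        exact eLpNorm_comp_add_right_sub_two_le hg.aestronglyMeasurable hs hC hh
    _ = (C * eVariationOn g s * ENNReal.ofReal h ^ (ε : ℝ)) ^ (1 / 2 : ℝ) := by
        rw [← ENNReal.mul_rpow_of_nonneg _ _ (by norm_num), ENNReal.ofReal_inv_of_pos hh,
          ENNReal.rpow_add _ _ hh0 ENNReal.ofReal_ne_top, ENNReal.rpow_one, mul_assoc,
          mul_right_comm (ENNReal.ofReal h), ENNReal.mul_inv_cancel hh0 ENNReal.ofReal_ne_top,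
          one_mul]

theorem univ_subset_Icc_union_iUnion_abs_mul_mem_Icc :
    (Set.univ : Set ℝ) ⊆ Set.Icc (-1) 1 ∪
      ⋃ k : ℕ, {u | |(1 / 2) ^ (k + 2) * u| ∈ Set.Icc (1 / 4) (1 / 2)} := by
  rintro u -
  rcases le_total |u| 1 with hu | hu
  · exact Or.inl (abs_le.1 hu)
  · obtain ⟨k, hk1, hk2⟩ := exists_nat_pow_near hu one_lt_two
    refine Or.inr (Set.mem_iUnion.2 ⟨k, ?_⟩)
    have hp : (0 : ℝ) < 2 ^ k := by positivity
    rw [pow_succ] at hk2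
    rw [Set.mem_ofPred_eq, abs_mul, abs_of_pos (by positivity), one_div_pow, one_div_mul_eq_div,
      pow_add, Set.mem_Icc, le_div_iff₀ (by positivity), div_le_iff₀ (by positivity)]
    constructor <;> linarith

theorem integrable_fourier_of_boundedVariationOn_of_holderOnWith {C ε : ℝ≥0} (hε : 0 < ε)
    {s : Set ℝ} (hV : BoundedVariationOn g s) (hC : HolderOnWith C ε g s) (hs : ∀ᵐ x, x ∈ s)
    (hg : Integrable g) (hg2 : MemLp g 2) : Integrable (𝓕 g) := by
  have hcont := continuous_fourier_of_integrable hg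
  refine ⟨hcont.aestronglyMeasurable, ?_⟩
  set A : ℝ≥0∞ := (C * eVariationOn g s) ^ (1 / 2 : ℝ) with hA
  set q : ℝ≥0∞ := 2⁻¹ ^ (ε / 2 : ℝ) with hq
  have hA_ne : A ≠ ⊤ := (ENNReal.rpow_lt_top_of_nonneg (by norm_num)
    (ENNReal.mul_ne_top ENNReal.coe_ne_top hV)).ne
  have hq_lt : q < 1 := ENNReal.rpow_lt_one ENNReal.one_half_lt_one (by positivity)
  have hcenter : ∫⁻ u in Set.Icc (-1 : ℝ) 1, ‖𝓕 g u‖ₑ < ⊤ := hcont.integrableOn_Icc.2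
  have hshell (k : ℕ) : ∫⁻ u in {u : ℝ | |(1 / 2) ^ (k + 2) * u| ∈ Set.Icc (1 / 4) (1 / 2)},
      ‖𝓕 g u‖ₑ ≤ A * q ^ (k + 2) := by
    refine (setLIntegral_enorm_fourier_le_of_holderOnWith hC hs hg hg2 (by positivity)).trans_eq ?_
    have hhalf : ENNReal.ofReal ((1 / 2 : ℝ) ^ (k + 2)) = 2⁻¹ ^ (k + 2) := by
      rw [ENNReal.ofReal_pow (by norm_num), one_div, ENNReal.ofReal_inv_of_pos two_pos,
        ENNReal.ofReal_ofNat]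
    rw [ENNReal.mul_rpow_of_nonneg _ _ (by norm_num), ← hA, hhalf, hq, ← ENNReal.rpow_mul,
      mul_one_div, ← ENNReal.rpow_natCast, ← ENNReal.rpow_natCast, ← ENNReal.rpow_mul,
      ← ENNReal.rpow_mul, mul_comm (ε / 2 : ℝ)]
  have hsum : ∑' k : ℕ, A * q ^ (k + 2) < ⊤ := by
    simp only [pow_add]
    rw [ENNReal.tsum_mul_left, ENNReal.tsum_mul_right, ENNReal.tsum_geometric]
    finiteness [hA_ne, hq_lt.ne_top, ENNReal.inv_ne_top.2 (tsub_pos_of_lt hq_lt).ne']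
  calc ∫⁻ u, ‖𝓕 g u‖ₑ
      ≤ ∫⁻ u in Set.Icc (-1) 1 ∪
          ⋃ k : ℕ, {u | |(1 / 2) ^ (k + 2) * u| ∈ Set.Icc (1 / 4) (1 / 2)}, ‖𝓕 g u‖ₑ := by
        rw [← setLIntegral_univ]
        exact lintegral_mono_set univ_subset_Icc_union_iUnion_abs_mul_mem_Icc
    _ ≤ (∫⁻ u in Set.Icc (-1 : ℝ) 1, ‖𝓕 g u‖ₑ) + ∑' k : ℕ, A * q ^ (k + 2) :=
        (lintegral_union_le _ _ _).trans (add_le_add_right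
          ((lintegral_iUnion_le _ _).trans (ENNReal.tsum_le_tsum hshell)) _)
    _ < ⊤ := ENNReal.add_lt_top.2 ⟨hcenter, hsum⟩

end Bernstein

section ArcIntegral

theorem periodic_comp_add_coe {T : ℝ} {E : Type*} (f : AddCircle T → E) (x : AddCircle T) :
    Function.Periodic (fun s : ℝ => f (x + s)) T := fun s => by
  simp only [AddCircle.coe_add_period]

theorem fourier_add_right {T : ℝ} (k : ℤ) (x y : AddCircle T) :
    fourier k (x + y) = fourier k x * fourier k y := by
  rw [fourier_apply, smul_add, AddCircle.toCircle_add, Circle.coe_mul, fourier_apply, fourier_apply]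

variable {T : ℝ} {E : Type*} [NormedAddCommGroup E]

/-- The integral of `f` along the arc of signed length `t` that starts at `x`: the indefinite
integral of `f`, whose difference quotients at `t = 0` define the `d`-points. -/
noncomputable def arcIntegral [NormedSpace ℝ E] (f : AddCircle T → E) (x : AddCircle T)
    (t : ℝ) : E :=
  ∫ s in (0 : ℝ)..t, f (x + s)

theorem arcIntegral_zero [NormedSpace ℝ E] (f : AddCircle T → E) (x : AddCircle T) :
    arcIntegral f x 0 = 0 :=
  intervalIntegral.integral_same

theorem arcIntegral_smul [NormedSpace ℝ E] {𝕜 : Type*} [NormedDivisionRing 𝕜] [Module 𝕜 E]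
    [NormSMulClass 𝕜 E] [SMulCommClass ℝ 𝕜 E] (c : 𝕜) (f : AddCircle T → E) (x : AddCircle T)
    (t : ℝ) :
    arcIntegral (c • f) x t = c • arcIntegral f x t :=
  intervalIntegral.integral_smul c _

theorem mul_arcIntegral_fourier (k : ℤ) (x : AddCircle T) (t : ℝ) :
    2 * π * Complex.I * k / T * arcIntegral (fourier k) x t =
      (fourier k (t : AddCircle T) - 1) * fourier k x := by
  have hftc : ∫ s in (0 : ℝ)..t, 2 * π * Complex.I * k / T * fourier k (s : AddCircle T) =
      fourier k (t : AddCircle T) - 1 := by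
    rw [intervalIntegral.integral_eq_sub_of_hasDerivAt (fun s _ => hasDerivAt_fourier T k s)
      (Continuous.intervalIntegrable (by fun_prop) _ _), QuotientAddGroup.mk_zero,
      fourier_eval_zero]
  simp only [arcIntegral, fourier_add_right]
  rw [← hftc, intervalIntegral.integral_const_mul, intervalIntegral.integral_const_mul]
  ring

variable [hT : Fact (0 < T)] {f g : AddCircle T → E}

theorem intervalIntegrable_comp_add_coe (hf : Integrable f AddCircle.haarAddCircle)
    (x : AddCircle T) (a b : ℝ) :
    IntervalIntegrable (fun s : ℝ => f (x + s)) volume a b := by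
  have hvol : Integrable f := by
    rw [AddCircle.volume_eq_smul_haarAddCircle]
    exact hf.smul_measure ENNReal.ofReal_ne_top
  refine (periodic_comp_add_coe f x).intervalIntegrable₀ hT.out.ne' ?_ a b
  rw [intervalIntegrable_iff_integrableOn_Ioc_of_le hT.out.le]
  have := (AddCircle.measurePreserving_mk T 0).integrable_comp_of_integrable (hvol.comp_add_left x)
  rwa [zero_add] at this

theorem intervalIntegral_comp_add_coe_period [NormedSpace ℝ E] (f : AddCircle T → E)
    (x : AddCircle T) (a : ℝ) :
    ∫ s in a..a + T, f (x + s) = T • ∫ y, f y ∂AddCircle.haarAddCircle := by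
  rw [AddCircle.intervalIntegral_preimage T a fun y => f (x + y),
    integral_add_left_eq_self (μ := volume) f x, AddCircle.integral_haarAddCircle,
    smul_inv_smul₀ hT.out.ne']

theorem intervalIntegral_norm_comp_add_coe_le (hf : Integrable f AddCircle.haarAddCircle)
    (x : AddCircle T) {a b : ℝ} (hab : a ≤ b) :
    ∫ s in a..b, ‖f (x + s)‖ ≤ (b - a + T) * ∫ y, ‖f y‖ ∂AddCircle.haarAddCircle := by
  have hper := periodic_comp_add_coe (fun y => ‖f y‖) x
  have hint := fun c d => (intervalIntegrable_comp_add_coe hf x c d).norm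
  set n := ⌈(b - a) / T⌉₊
  have hn : b - a ≤ n * T := (div_le_iff₀ hT.out).1 (Nat.le_ceil _)
  have hn' : n * T ≤ b - a + T := by
    have hceil := Nat.ceil_lt_add_one (div_nonneg (sub_nonneg.2 hab) hT.out.le)
    rw [← div_self hT.out.ne', ← add_div] at hceil
    exact ((lt_div_iff₀ hT.out).1 hceil).le
  calc ∫ s in a..b, ‖f (x + s)‖
      ≤ ∫ s in a..a + (n : ℤ) • T, ‖f (x + s)‖ := by
        refine intervalIntegral.integral_mono_interval le_rfl hab ?_
          (Eventually.of_forall fun s => norm_nonneg _) (hint _ _)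
        rw [natCast_zsmul, nsmul_eq_mul]
        linarith
    _ = n * T * ∫ y, ‖f y‖ ∂AddCircle.haarAddCircle := by
        rw [hper.intervalIntegral_add_zsmul_eq n a hint,
          intervalIntegral_comp_add_coe_period (fun y => ‖f y‖), natCast_zsmul, nsmul_eq_mul,
          smul_eq_mul, mul_assoc]
    _ ≤ (b - a + T) * ∫ y, ‖f y‖ ∂AddCircle.haarAddCircle := by
        gcongr

variable [NormedSpace ℝ E]

theorem norm_arcIntegral_le (hf : Integrable f AddCircle.haarAddCircle) (x : AddCircle T) (t : ℝ) :
    ‖arcIntegral f x t‖ ≤ (|t| + T) * ∫ y, ‖f y‖ ∂AddCircle.haarAddCircle := by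
  rcases le_total 0 t with ht | ht
  · refine (intervalIntegral.norm_integral_le_integral_norm ht).trans ?_
    simpa [abs_of_nonneg ht] using intervalIntegral_norm_comp_add_coe_le hf x ht
  · rw [arcIntegral, intervalIntegral.integral_symm, norm_neg]
    refine (intervalIntegral.norm_integral_le_integral_norm ht).trans ?_
    simpa [abs_of_nonpos ht] using intervalIntegral_norm_comp_add_coe_le hf x ht

theorem continuous_arcIntegral (hf : Integrable f AddCircle.haarAddCircle) (x : AddCircle T) :
    Continuous (arcIntegral f x) :=
  intervalIntegral.continuous_primitive (intervalIntegrable_comp_add_coe hf x) 0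

theorem arcIntegral_add (hf : Integrable f AddCircle.haarAddCircle)
    (hg : Integrable g AddCircle.haarAddCircle) (x : AddCircle T) (t : ℝ) :
    arcIntegral (f + g) x t = arcIntegral f x t + arcIntegral g x t :=
  intervalIntegral.integral_add (intervalIntegrable_comp_add_coe hf x 0 t)
    (intervalIntegrable_comp_add_coe hg x 0 t)

theorem exists_norm_arcIntegral_le_mul_abs (hf : Integrable f AddCircle.haarAddCircle)
    {x : AddCircle T} (hx : DifferentiableAt ℝ (arcIntegral f x) 0) :
    ∃ M, ∀ t : ℝ, ‖arcIntegral f x t‖ ≤ M * |t| := by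
  obtain ⟨c, hc⟩ := hx.isBigO_sub.bound
  obtain ⟨δ, hδ, hnear⟩ := Metric.eventually_nhds_iff.1 hc
  simp only [dist_zero_right, Real.norm_eq_abs, sub_zero, arcIntegral_zero] at hnear
  set J := ∫ y, ‖f y‖ ∂AddCircle.haarAddCircle
  have hT0 : 0 < T := hT.out
  refine ⟨max c ((1 + T / δ) * J), fun t => ?_⟩
  rcases lt_or_ge |t| δ with ht | ht
  · exact (hnear ht).trans (by gcongr; exact le_max_left _ _)
  · calc ‖arcIntegral f x t‖ ≤ (|t| + T) * J := norm_arcIntegral_le hf x t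
      _ ≤ (|t| + T * (|t| / δ)) * J := by
          gcongr
          exact le_mul_of_one_le_right hT0.le ((one_le_div hδ).2 ht)
      _ = (1 + T / δ) * J * |t| := by ring
      _ ≤ max c ((1 + T / δ) * J) * |t| := by gcongr; exact le_max_right _ _

end ArcIntegral

section L1Functional

variable {α 𝕜 E F : Type*} [MeasurableSpace α] [RCLike 𝕜] [NormedAddCommGroup E] [NormedSpace 𝕜 E]
  [NormedAddCommGroup F] [NormedSpace 𝕜 F]

/-- `D` restricts to a bounded linear functional on `L¹(μ)`. Stating this for functions instead of
elements of `Lp E 1 μ` allows `D` to be given by a pointwise formula. -/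
structure IsL1Functional (𝕜 : Type*) [RCLike 𝕜] [NormedSpace 𝕜 E] [NormedSpace 𝕜 F] (μ : Measure α)
    (D : (α → E) → F) : Prop where
  map_add : ∀ {f g}, Integrable f μ → Integrable g μ → D (f + g) = D f + D g
  map_smul : ∀ (c : 𝕜) {f}, Integrable f μ → D (c • f) = c • D f
  bound : ∃ C, ∀ f, Integrable f μ → ‖D f‖ ≤ C * ∫ y, ‖f y‖ ∂μ

namespace IsL1Functional

variable {μ : Measure α} {D : (α → E) → F}

theorem congr_ae (hD : IsL1Functional 𝕜 μ D) {f g : α → E} (hf : Integrable f μ)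
    (hfg : f =ᵐ[μ] g) : D f = D g := by
  obtain ⟨C, hC⟩ := hD.bound
  have hg : Integrable g μ := hf.congr hfg
  have hnull : ∫ y, ‖(f - g) y‖ ∂μ = 0 := by
    refine integral_eq_zero_of_ae ?_
    filter_upwards [hfg] with y hy
    simp [hy]
  have hsub : D (f - g) = 0 := by
    simpa only [hnull, mul_zero, norm_le_zero_iff] using hC _ (hf.sub hg)
  rw [← sub_add_cancel f g, hD.map_add (hf.sub hg) hg, hsub, zero_add]

theorem exists_continuousLinearMap (hD : IsL1Functional 𝕜 μ D) :
    ∃ L : (α →₁[μ] E) →L[𝕜] F, ∀ p : α →₁[μ] E, L p = D p := by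
  obtain ⟨C, hC⟩ := hD.bound
  refine ⟨LinearMap.mkContinuous
    { toFun := fun p => D p
      map_add' := fun p q => ?_
      map_smul' := fun c p => ?_ } C fun p => ?_, fun p => rfl⟩
  · rw [hD.congr_ae (L1.integrable_coeFn _) (Lp.coeFn_add p q),
      hD.map_add (L1.integrable_coeFn p) (L1.integrable_coeFn q)]
  · rw [hD.congr_ae (L1.integrable_coeFn _) (Lp.coeFn_smul c p),
      hD.map_smul c (L1.integrable_coeFn p), RingHom.id_apply]
  · rw [L1.norm_eq_integral_norm]
    exact hC p (L1.integrable_coeFn p)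

theorem eq_of_forall_fourier_eq {T : ℝ} [Fact (0 < T)] {F : Type*} [NormedAddCommGroup F]
    [NormedSpace ℂ F] {D₁ D₂ : (AddCircle T → ℂ) → F}
    (h₁ : IsL1Functional ℂ AddCircle.haarAddCircle D₁)
    (h₂ : IsL1Functional ℂ AddCircle.haarAddCircle D₂)
    (hfourier : ∀ k : ℤ, D₁ (fourier k) = D₂ (fourier k)) {f : AddCircle T → ℂ}
    (hf : Integrable f AddCircle.haarAddCircle) : D₁ f = D₂ f := by
  obtain ⟨L₁, hL₁⟩ := h₁.exists_continuousLinearMap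
  obtain ⟨L₂, hL₂⟩ := h₂.exists_continuousLinearMap
  have hmonomials : Set.EqOn L₁ L₂ (Set.range (fourierLp (T := T) 1)) := by
    rintro _ ⟨k, rfl⟩
    rw [hL₁, hL₂, h₁.congr_ae (L1.integrable_coeFn _) (coeFn_fourierLp 1 k),
      h₂.congr_ae (L1.integrable_coeFn _) (coeFn_fourierLp 1 k), hfourier]
  have hL : L₁ = L₂ := ContinuousLinearMap.ext_on
    (Submodule.dense_iff_topologicalClosure_eq_top.2
      (span_fourierLp_closure_eq_top ENNReal.one_ne_top)) hmonomials
  rw [h₁.congr_ae hf hf.coeFn_toL1.symm, h₂.congr_ae hf hf.coeFn_toL1.symm, ← hL₁, ← hL₂, hL]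

end IsL1Functional

end L1Functional

section KernelMean

variable {T : ℝ} [hT : Fact (0 < T)] {K : ℝ → ℂ} {f : AddCircle T → ℂ}

/-- The mean of `f` at `x` on the scale `T / N`, integrated by parts: `K` plays the role of a
primitive of the averaging kernel and is paired with the indefinite integral of `f`. The factor in
front makes it multiply the `k`-th character by `dslope (𝓕⁻ K) 0 (k / N)`. -/
noncomputable def kernelMean (K : ℝ → ℂ) (f : AddCircle T → ℂ) (N : ℝ) (x : AddCircle T) : ℂ :=
  2 * π * Complex.I * N / T * ∫ v, K v * arcIntegral f x (T * v / N)

theorem integrable_mul_affine_abs (hK : Integrable K) (hK' : Integrable fun v : ℝ => v • K v)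
    (a b : ℝ) : Integrable fun v => ‖K v‖ * (|a * v| + b) := by
  refine ((hK'.norm.const_mul |a|).add (hK.norm.const_mul b)).congr
    (Eventually.of_forall fun v => ?_)
  simp only [Pi.add_apply, norm_smul, Real.norm_eq_abs, abs_mul]
  ring

theorem norm_mul_arcIntegral_le (K : ℝ → ℂ) (hf : Integrable f AddCircle.haarAddCircle) (N : ℝ)
    (x : AddCircle T) (v : ℝ) :
    ‖K v * arcIntegral f x (T * v / N)‖ ≤
      ‖K v‖ * (|T / N * v| + T) * ∫ y, ‖f y‖ ∂AddCircle.haarAddCircle := by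
  rw [norm_mul, mul_assoc, div_mul_eq_mul_div]
  gcongr
  exact norm_arcIntegral_le hf x _

theorem integrable_mul_arcIntegral (hK : Integrable K) (hK' : Integrable fun v : ℝ => v • K v)
    (hf : Integrable f AddCircle.haarAddCircle) (N : ℝ) (x : AddCircle T) :
    Integrable fun v => K v * arcIntegral f x (T * v / N) :=
  ((integrable_mul_affine_abs hK hK' (T / N) T).mul_const _).mono'
    (hK.aestronglyMeasurable.mul
      ((continuous_arcIntegral hf x).comp (by fun_prop)).aestronglyMeasurable)
    (Eventually.of_forall fun v => norm_mul_arcIntegral_le K hf N x v)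

theorem isL1Functional_kernelMean (hK : Integrable K) (hK' : Integrable fun v : ℝ => v • K v)
    (N : ℝ) (x : AddCircle T) :
    IsL1Functional ℂ AddCircle.haarAddCircle fun f => kernelMean K f N x where
  map_add hf hg := by
    simp only [kernelMean, arcIntegral_add hf hg, mul_add]
    rw [integral_add (integrable_mul_arcIntegral hK hK' hf N x)
      (integrable_mul_arcIntegral hK hK' hg N x), mul_add]
  map_smul c f _ := by
    simp only [kernelMean, arcIntegral_smul, smul_eq_mul, mul_left_comm _ c]
    rw [integral_const_mul, mul_left_comm]
  bound := by
    refine ⟨‖2 * π * Complex.I * N / T‖ * ∫ v, ‖K v‖ * (|T / N * v| + T), fun f hf => ?_⟩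
    rw [kernelMean, norm_mul, mul_assoc ‖_‖, ← integral_mul_const]
    gcongr
    exact norm_integral_le_of_norm_le
      ((integrable_mul_affine_abs hK hK' (T / N) T).mul_const _)
      (Eventually.of_forall fun v => norm_mul_arcIntegral_le K hf N x v)

theorem deriv_fourierInv_zero (hK : Integrable K) (hK' : Integrable fun v : ℝ => v • K v) :
    deriv (𝓕⁻ K) 0 = ∫ v : ℝ, 2 * π * Complex.I * v * K v := by
  have hderiv : HasDerivAt (fun y => 𝓕 K (-y)) _ 0 :=
    HasDerivAt.scomp 0 (by rw [neg_zero]; exact Real.hasDerivAt_fourier hK hK' 0) (hasDerivAt_neg 0)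
  rw [funext (Real.fourierInv_eq_fourier_neg K), hderiv.deriv, Real.fourier_eq, neg_one_smul,
    ← integral_neg]
  simp

theorem mul_kernelMean_fourier (hK : Integrable K) {N : ℝ} (hN : N ≠ 0) (k : ℤ)
    (x : AddCircle T) :
    k / N * kernelMean K (fourier k) N x = (𝓕⁻ K (k / N) - 𝓕⁻ K 0) * fourier k x := by
  have hNC : (N : ℂ) ≠ 0 := Complex.ofReal_ne_zero.2 hN
  have hTC : (T : ℂ) ≠ 0 := Complex.ofReal_ne_zero.2 hT.out.ne'
  have hchar (v : ℝ) : fourier k ((T * v / N : ℝ) : AddCircle T) = 𝐞 (v * (k / N)) := by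
    rw [fourier_coe_apply, Real.fourierChar_apply]
    push_cast
    field_simp
  have hmod : Integrable fun v => 𝐞 (v * (k / N)) • K v := by
    simpa [mul_comm] using (Real.fourierIntegral_convergent_iff (-(k / N : ℝ))).2 hK
  calc k / N * kernelMean K (fourier k) N x
      = ∫ v, K v * (2 * π * Complex.I * k / T * arcIntegral (fourier k) x (T * v / N)) := by
        rw [kernelMean, ← integral_const_mul, ← integral_const_mul]
        congr with v
        field_simp
    _ = ∫ v, (𝐞 (v * (k / N)) • K v - K v) * fourier k x := by
        simp only [mul_arcIntegral_fourier, hchar, Circle.smul_def, smul_eq_mul]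
        congr with v
        ring
    _ = (𝓕⁻ K (k / N) - 𝓕⁻ K 0) * fourier k x := by
        rw [integral_mul_const, integral_sub hmod hK]
        simp [Real.fourierInv_eq, mul_comm]

theorem kernelMean_fourier_zero (hK : Integrable K) (hK' : Integrable fun v : ℝ => v • K v) {N : ℝ}
    (hN : N ≠ 0) (x : AddCircle T) : kernelMean K (fourier 0) N x = deriv (𝓕⁻ K) 0 := by
  have hNC : (N : ℂ) ≠ 0 := Complex.ofReal_ne_zero.2 hN
  have hTC : (T : ℂ) ≠ 0 := Complex.ofReal_ne_zero.2 hT.out.ne'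
  have harc (v : ℝ) : arcIntegral (fourier 0) x (T * v / N) = (T * v / N : ℝ) := by
    simp [arcIntegral]
  simp only [kernelMean, harc]
  rw [deriv_fourierInv_zero hK hK', ← integral_const_mul]
  congr with v
  push_cast
  field_simp

theorem kernelMean_fourier (hK : Integrable K) (hK' : Integrable fun v : ℝ => v • K v) {N : ℝ}
    (hN : N ≠ 0) (k : ℤ) (x : AddCircle T) :
    kernelMean K (fourier k) N x = dslope (𝓕⁻ K) 0 (k / N) * fourier k x := by
  rcases eq_or_ne k 0 with rfl | hk
  · rw [kernelMean_fourier_zero hK hK' hN, Int.cast_zero, zero_div, dslope_same, fourier_zero,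
      mul_one]
  · have hkN : (k : ℝ) / N ≠ 0 := div_ne_zero (Int.cast_ne_zero.2 hk) hN
    rw [dslope_of_ne _ hkN, slope, vsub_eq_sub, sub_zero, Complex.real_smul, mul_assoc,
      ← mul_kernelMean_fourier hK hN, Complex.ofReal_inv, eq_comm]
    push_cast
    exact inv_mul_cancel_left₀ (mod_cast hkN) _

theorem tendsto_kernelMean (hK : Integrable K) (hK' : Integrable fun v : ℝ => v • K v)
    (hf : Integrable f AddCircle.haarAddCircle) {x : AddCircle T} {d : ℂ}
    (hd : HasDerivAt (arcIntegral f x) d 0) :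
    Tendsto (fun N => kernelMean K f N x) atTop (𝓝 (deriv (𝓕⁻ K) 0 * d)) := by
  obtain ⟨M, hM⟩ := exists_norm_arcIntegral_le_mul_abs hf hd.differentiableAt
  have hT0 : 0 < T := hT.out
  have hTC : (T : ℂ) ≠ 0 := Complex.ofReal_ne_zero.2 hT0.ne'
  have hlim (v : ℝ) : Tendsto (fun N : ℝ => (N : ℂ) * arcIntegral f x (T * v / N)) atTop
      (𝓝 (T * v * d)) := by
    have h := hd.hasFDerivAt.lim_real (T * v)
    simp only [zero_add, arcIntegral_zero, sub_zero, smul_eq_mul, Complex.real_smul] at h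
    simpa [div_eq_inv_mul] using h
  rw [deriv_fourierInv_zero hK hK', ← integral_mul_const]
  simp only [kernelMean, ← integral_const_mul]
  refine tendsto_integral_filter_of_dominated_convergence (fun v => 2 * π * M * ‖v • K v‖) ?_ ?_
    (hK'.norm.const_mul _) (Eventually.of_forall fun v => ?_)
  · exact Eventually.of_forall fun N =>
      ((integrable_mul_arcIntegral hK hK' hf N x).const_mul _).aestronglyMeasurable
  · filter_upwards [eventually_gt_atTop 0] with N hN
    refine Eventually.of_forall fun v => ?_
    calc ‖2 * π * Complex.I * N / T * (K v * arcIntegral f x (T * v / N))‖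
        = 2 * π * N / T * (‖K v‖ * ‖arcIntegral f x (T * v / N)‖) := by
          simp [abs_of_pos, Real.pi_pos, hN, hT0]
      _ ≤ 2 * π * N / T * (‖K v‖ * (M * |T * v / N|)) := by gcongr; exact hM _
      _ = 2 * π * M * ‖v • K v‖ := by
          rw [abs_div, abs_mul, abs_of_pos hN, abs_of_pos hT0, norm_smul, Real.norm_eq_abs]
          field_simp
  · refine ((hlim v).const_mul (2 * π * Complex.I / T * K v)).congr' ?_ |>.trans_eq ?_
    · exact Eventually.of_forall fun N => by ring
    · congr 1
      field_simp

end KernelMean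

section PhiMean

theorem norm_fourierCoeff_le {T : ℝ} [Fact (0 < T)] {E : Type*} [NormedAddCommGroup E]
    [NormedSpace ℂ E] (f : AddCircle T → E) (k : ℤ) :
    ‖fourierCoeff f k‖ ≤ ∫ y, ‖f y‖ ∂AddCircle.haarAddCircle := by
  refine (norm_integral_le_integral_norm _).trans_eq ?_
  simp only [norm_smul, fourier_apply, Circle.norm_coe, one_mul]

theorem isL1Functional_phiMean (φ : ℝ → ℂ) (n : ℕ) (x : AddCircle (2 * π)) :
    IsL1Functional ℂ AddCircle.haarAddCircle fun f => phiMean φ f n x where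
  map_add hf hg := by
    simp only [phiMean, fourierCoeff.add hf hg, Pi.add_apply, mul_add, add_mul,
      Finset.sum_add_distrib]
  map_smul c f _ := by
    simp only [phiMean, fourierCoeff.const_smul, smul_eq_mul, Finset.mul_sum]
    exact Finset.sum_congr rfl fun k _ => by ring
  bound := by
    refine ⟨∑ k ∈ Finset.Icc (-(n : ℤ)) (n : ℤ), ‖φ ((k : ℝ) / ((n : ℝ) + 1))‖, fun f _ => ?_⟩
    rw [Finset.sum_mul]
    refine norm_sum_le_of_le _ fun k _ => ?_
    rw [norm_mul, norm_mul, fourier_apply, Circle.norm_coe, mul_one]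
    gcongr
    exact norm_fourierCoeff_le f k

theorem phiMean_fourier {φ : ℝ → ℂ} (hφ : ∀ y, 1 ≤ |y| → φ y = 0) (n : ℕ) (k : ℤ)
    (x : AddCircle (2 * π)) :
    phiMean φ (fourier k) n x = φ (k / (n + 1)) * fourier k x := by
  rw [phiMean, fourierCoeff_fourier, Finset.sum_eq_single k]
  · rw [Pi.single_eq_same, mul_one]
  · intro j _ hj
    rw [Pi.single_eq_of_ne hj, mul_zero, zero_mul]
  · intro hk
    rw [Finset.mem_Icc, ← abs_le, not_le] at hk
    have hk' : (n : ℝ) + 1 ≤ |(k : ℝ)| := mod_cast hk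
    rw [hφ, zero_mul, zero_mul]
    have hn : (0 : ℝ) < n + 1 := n.cast_add_one_pos
    rwa [abs_div, abs_of_pos hn, one_le_div hn]

theorem hasDValueAt_iff_hasDerivAt {f : AddCircle (2 * π) → ℂ} {x : AddCircle (2 * π)} {d : ℂ} :
    HasDValueAt f x d ↔ HasDerivAt (arcIntegral f x) d 0 := by
  simp only [hasDerivAt_iff_tendsto_slope_zero, arcIntegral_zero, zero_add, sub_zero,
    Complex.real_smul, Complex.ofReal_inv]
  simp only [HasDValueAt, arcIntegral, one_div]

theorem phiMean_eq_kernelMean {φ K : ℝ → ℂ} (hφ : ∀ y, 1 ≤ |y| → φ y = 0) (hK : Integrable K)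
    (hK' : Integrable fun v : ℝ => v • K v) (hφK : dslope (𝓕⁻ K) 0 = φ)
    {f : AddCircle (2 * π) → ℂ} (hf : Integrable f AddCircle.haarAddCircle) (n : ℕ)
    (x : AddCircle (2 * π)) : phiMean φ f n x = kernelMean K f (n + 1) x := by
  refine (isL1Functional_phiMean φ n x).eq_of_forall_fourier_eq
    (isL1Functional_kernelMean hK hK' (n + 1) x) (fun k => ?_) hf
  rw [phiMean_fourier hφ, kernelMean_fourier hK hK' n.cast_add_one_ne_zero, hφK]

theorem tendsto_phiMean_of_dslope_fourierInv_eq {φ K : ℝ → ℂ} (hφ : ∀ y, 1 ≤ |y| → φ y = 0)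
    (hK : Integrable K) (hK' : Integrable fun v : ℝ => v • K v) (hφK : dslope (𝓕⁻ K) 0 = φ)
    {f : AddCircle (2 * π) → ℂ} (hf : Integrable f AddCircle.haarAddCircle)
    {x : AddCircle (2 * π)} {d : ℂ} (hd : HasDValueAt f x d) :
    Tendsto (fun n => phiMean φ f n x) atTop (𝓝 (φ 0 * d)) := by
  simp only [phiMean_eq_kernelMean hφ hK hK' hφK hf]
  rw [← hφK, dslope_same]
  exact (tendsto_kernelMean hK hK' hf (hasDValueAt_iff_hasDerivAt.1 hd)).comp
    (tendsto_atTop_add_const_right _ 1 tendsto_natCast_atTop_atTop)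

end PhiMean

section FourierIntegrability

variable {g : ℝ → ℂ} {s : Set ℝ} {ε : ℝ≥0}

theorem BVLipOn.exists_norm_le (hg : BVLipOn ε g s) : ∃ M, ∀ x ∈ s, ‖g x‖ ≤ M := by
  rcases s.eq_empty_or_nonempty with rfl | ⟨y, hy⟩
  · exact ⟨0, fun x hx => hx.elim⟩
  · refine ⟨‖g y‖ + (eVariationOn g s).toReal, fun x hx => ?_⟩
    calc ‖g x‖ ≤ ‖g y‖ + ‖g x - g y‖ := norm_le_norm_add_norm_sub' _ _
      _ ≤ ‖g y‖ + (eVariationOn g s).toReal := by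
          rw [← dist_eq_norm]
          gcongr
          exact hg.1.dist_le hx hy

theorem BVLipOn.aestronglyMeasurable (hε : 0 < ε) (hg : BVLipOn ε g s) (hsm : MeasurableSet s)
    (hs : ∀ᵐ x, x ∈ s) : AEStronglyMeasurable g := by
  obtain ⟨-, C, hC⟩ := hg
  rw [← Measure.restrict_eq_self_of_ae_mem hs]
  exact (hC.continuousOn hε).aestronglyMeasurable hsm

theorem BVLipOn.memLp (hε : 0 < ε) (hg : BVLipOn ε g s) (hsm : MeasurableSet s)
    (hs : ∀ᵐ x, x ∈ s) (hcs : HasCompactSupport g) (p : ℝ≥0∞) : MemLp g p := by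
  obtain ⟨M, hM⟩ := hg.exists_norm_le
  exact hcs.memLp_of_bound (hg.aestronglyMeasurable hε hsm hs) M (hs.mono hM)

theorem BVLipOn.integrable_fourier (hε : 0 < ε) (hg : BVLipOn ε g s) (hsm : MeasurableSet s)
    (hs : ∀ᵐ x, x ∈ s) (hcs : HasCompactSupport g) : Integrable (𝓕 g) := by
  have hmem := hg.memLp hε hsm hs hcs
  obtain ⟨hV, C, hC⟩ := hg
  exact integrable_fourier_of_boundedVariationOn_of_holderOnWith hε hV hC hs
    (memLp_one_iff_integrable.1 (hmem 1)) (hmem 2)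

variable {E : Type*} [NormedAddCommGroup E]

theorem integrable_of_integrable_id_smul [NormedSpace ℝ E] {K : ℝ → E} (hc : Continuous K)
    (hK' : Integrable fun v : ℝ => v • K v) : Integrable K := by
  have hnear : Integrable ((Set.Icc (-1 : ℝ) 1).indicator K) :=
    (integrable_indicator_iff measurableSet_Icc).2 hc.integrableOn_Icc
  refine (hnear.norm.add hK'.norm).mono' hc.aestronglyMeasurable (Eventually.of_forall fun v => ?_)
  simp only [Pi.add_apply, norm_smul, Real.norm_eq_abs]
  by_cases hv : v ∈ Set.Icc (-1 : ℝ) 1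
  · rw [Set.indicator_of_mem hv]
    exact le_add_of_nonneg_right (by positivity)
  · rw [Set.indicator_of_notMem hv, norm_zero, zero_add]
    rw [Set.mem_Icc, ← abs_le, not_le] at hv
    exact le_mul_of_one_le_left (norm_nonneg _) hv.le

variable [NormedSpace ℂ E] {P : ℝ → E}

theorem integrable_id_smul_fourier (hP : Integrable P) (hdiff : Differentiable ℝ P)
    (hderiv : Integrable (deriv P)) (hF : Integrable (𝓕 (deriv P))) :
    Integrable fun v : ℝ => v • 𝓕 P v := by
  rw [Real.fourier_deriv hP hdiff hderiv] at hF
  refine (hF.smul (2 * π * Complex.I)⁻¹).congr (Eventually.of_forall fun v => ?_)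
  simp only [Pi.smul_apply, smul_smul, inv_mul_cancel_left₀ Complex.two_pi_I_ne_zero,
    Complex.coe_smul]

end FourierIntegrability

section Multiplier

variable {𝕜 E : Type*} [NontriviallyNormedField 𝕜] [NormedAddCommGroup E] [NormedSpace 𝕜 E]

theorem hasDerivAt_id_smul_zero {φ : 𝕜 → E} (hφ : ContinuousAt φ 0) :
    HasDerivAt (fun y => y • φ y) (φ 0) 0 := by
  rw [hasDerivAt_iff_tendsto_slope_zero]
  refine (hφ.tendsto.mono_left nhdsWithin_le_nhds).congr' ?_
  filter_upwards [self_mem_nhdsWithin] with y hy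
  rw [zero_add, zero_smul, sub_zero, inv_smul_smul₀ hy]

theorem hasDerivAt_id_smul {φ : 𝕜 → E} (hφ : ContinuousAt φ 0) (hd : DifferentiableOn 𝕜 φ {0}ᶜ)
    (x : 𝕜) : HasDerivAt (fun y => y • φ y) (φ x + x • deriv φ x) x := by
  rcases eq_or_ne x 0 with rfl | hx
  · simpa only [zero_smul, add_zero] using hasDerivAt_id_smul_zero hφ
  · have hφx := (hd.differentiableAt (isOpen_compl_singleton.mem_nhds hx)).hasDerivAt
    simpa only [id, one_smul, add_comm] using (hasDerivAt_id x).fun_smul hφx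

theorem dslope_id_smul_zero {φ : 𝕜 → E} (hφ : ContinuousAt φ 0) :
    dslope (fun y => y • φ y) 0 = φ := by
  ext y
  rcases eq_or_ne y 0 with rfl | hy
  · rw [dslope_same, (hasDerivAt_id_smul_zero hφ).deriv]
  · simpa only [sub_zero] using dslope_sub_smul_of_ne φ hy

variable {φ : ℝ → ℂ}

theorem tendsto_phiMean_of_integrable_fourier_deriv (hc : ContinuousAt φ 0)
    (hφ : ∀ y, 1 ≤ |y| → φ y = 0) (hdiff : Differentiable ℝ fun y => y • φ y)
    (hderiv : Integrable (deriv fun y => y • φ y))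
    (hF : Integrable (𝓕 (deriv fun y => y • φ y)))
    {f : AddCircle (2 * π) → ℂ} (hf : Integrable f AddCircle.haarAddCircle)
    {x : AddCircle (2 * π)} {d : ℂ} (hd : HasDValueAt f x d) :
    Tendsto (fun n => phiMean φ f n x) atTop (𝓝 (φ 0 * d)) := by
  set P : ℝ → ℂ := fun y => y • φ y with hP
  have hcs : HasCompactSupport P :=
    HasCompactSupport.intro (isCompact_Icc (a := (-1 : ℝ)) (b := 1)) fun y hy => by
      rw [Set.mem_Icc, ← abs_le, not_le] at hy
      simp only [hP, hφ y hy.le, smul_zero]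
  have hPi : Integrable P := hdiff.continuous.integrable_of_hasCompactSupport hcs
  have hK' : Integrable fun v : ℝ => v • 𝓕 P v := integrable_id_smul_fourier hPi hdiff hderiv hF
  have hK : Integrable (𝓕 P) :=
    integrable_of_integrable_id_smul (continuous_fourier_of_integrable hPi) hK'
  refine tendsto_phiMean_of_dslope_fourierInv_eq hφ hK hK' ?_ hf hd
  rw [hdiff.continuous.fourierInv_fourier_eq hPi hK, dslope_id_smul_zero hc]

theorem eq_zero_of_one_le_abs (hc : Continuous φ) (hsupp : tsupport φ ⊆ Set.Icc (-1) 1) {y : ℝ}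
    (hy : 1 ≤ |y|) : φ y = 0 := by
  have hopen : Function.support φ ⊆ Set.Ioo (-1) 1 := by
    rw [← interior_Icc]
    exact interior_maximal ((subset_tsupport φ).trans hsupp) hc.isOpen_support
  by_contra hne
  exact (abs_lt.2 (hopen hne)).not_ge hy

theorem corollary5_general (hdiff : DifferentiableOn ℝ φ {0}ᶜ)
    (hsupp : tsupport φ ⊆ Set.Icc (-1) 1) {ε : ℝ≥0} (hε : 0 < ε) (hφ : BVLipOn ε φ Set.univ)
    (hφ' : BVLipOn ε (fun x : ℝ => (x : ℂ) * deriv φ x) {0}ᶜ)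
    {f : AddCircle (2 * π) → ℂ} (hf : Integrable f AddCircle.haarAddCircle)
    {x : AddCircle (2 * π)} {d : ℂ} (hd : HasDValueAt f x d) :
    Tendsto (fun n => phiMean φ f n x) atTop (𝓝 (φ 0 * d)) := by
  set ψ : ℝ → ℂ := fun x => x * deriv φ x
  have hc : Continuous φ := by
    obtain ⟨-, C, hC⟩ := hφ
    exact (holderOnWith_univ.1 hC).continuous hε
  have hφcs : HasCompactSupport φ := isCompact_Icc.of_isClosed_subset (isClosed_tsupport φ) hsupp
  have hψcs : HasCompactSupport ψ := hφcs.deriv.mul_left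
  have hne : ∀ᵐ y : ℝ, y ∈ ({0}ᶜ : Set ℝ) := Measure.ae_ne volume 0
  have hφi : Integrable φ := hc.integrable_of_hasCompactSupport hφcs
  have hψi : Integrable ψ :=
    memLp_one_iff_integrable.1 (hφ'.memLp hε (measurableSet_singleton 0).compl hne hψcs 1)
  have hP := hasDerivAt_id_smul hc.continuousAt hdiff
  have hderiv : deriv (fun y => y • φ y) = φ + ψ := funext fun y => (hP y).deriv
  refine tendsto_phiMean_of_integrable_fourier_deriv hc.continuousAt
    (fun y hy => eq_zero_of_one_le_abs hc hsupp hy) (fun y => (hP y).differentiableAt)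
    (hderiv ▸ hφi.add hψi) ?_ hf hd
  have hadd : 𝓕 (φ + ψ) = 𝓕 φ + 𝓕 ψ := VectorFourier.fourierIntegral_add
    Real.continuous_fourierChar (innerSL ℝ).continuous₂ hφi hψi
  rw [hderiv, hadd]
  exact (hφ.integrable_fourier hε .univ (by simp) hφcs).add
    (hφ'.integrable_fourier hε (measurableSet_singleton 0).compl hne hψcs)

end Multiplier

theorem corollary5 (φ : ℝ → ℂ)
    (hcont : Continuous φ) (hC1 : ContDiffOn ℝ 1 φ {0}ᶜ)
    (hφ0 : φ 0 = 1) (hsupp : tsupport φ ⊆ Set.Icc (-1) 1)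
    (ε : ℝ≥0) (hε : 0 < ε)
    (hφ : BVLipOn ε φ Set.univ)
    (hφ' : BVLipOn ε (fun x : ℝ => (x : ℂ) * deriv φ x) {0}ᶜ)
    (f : AddCircle (2 * π) → ℂ) (hf : Integrable f AddCircle.haarAddCircle)
    (x : AddCircle (2 * π)) (d : ℂ) (hd : HasDValueAt f x d) :
    Tendsto (fun n : ℕ => phiMean φ f n x) atTop (𝓝 d) := by
  simpa only [hφ0, one_mul] using
    corollary5_general (hC1.differentiableOn one_ne_zero) hsupp hε hφ hφ' hf hd
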